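/- For a nonempty compact set $\sigma\subseteq\mathbb{C}=\mathbb{R}^2$ and $f:\sigma\to\mathbb{C}$ put $\operatorname{var}(f,\sigma)=\sup_S \operatorname{cvar}(f,S)/\operatorname{vf}(S)$, where the supremum is over all finite nonempty ordered lists $S=[x_0,\dots,x_n]$ of elements of $\sigma$. Here $\operatorname{cvar}(f,S)=\sum_{i=1}^n|f(x_i)-f(x_{i-1})|$, and $\operatorname{vf}(S)=\max_\ell \operatorname{vf}(S,\ell)$ is the maximum, over all lines $\ell$ in the plane, of the number $\operatorname{vf}(S,\ell)$ of indices $0\le i\le n-1$ for which at least one of the following holds: (i) $x_i$ and $x_{i+1}$ lie strictly on opposite sides of $\ell$; (ii) $i=0$ and $x_i\in\ell$; (iii) $i>0$, $x_i\in\ell$ and $x_{i-1}\notin\ell$; (iv) $i=n-1$, $x_i\notin\ell$ and $x_{i+1}\in\ell$. For a one-point list, $\operatorname{cvar}(f,[x_0])=0$ and $\operatorname{vf}([x_0])=1$. Let $BV(\sigma)$ be the Banach algebra (under pointwise operations) of all $f:\sigma\to\mathbb{C}$ with $\|f\|_{BV(\sigma)}=\|f\|_\infty+\operatorname{var}(f,\sigma)<\infty$,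 and let $AC(\sigma)$ be the closure in $BV(\sigma)$ of the set of restrictions to $\sigma$ of polynomials in the two real variables $x,y$ with complex coefficients. Two Banach algebras are called isomorphic if there is an algebra isomorphism between them that is continuous and has a continuous inverse. A $C$-set is a countably infinite compact set $\sigma\subseteq\mathbb{C}$ whose unique limit point is $0$. For a positive integer $k$, a $k$-ray set is a $C$-set $\sigma$ for which there are $k$ distinct rays $R_{\theta_1},\dots,R_{\theta_k}$, where $R_\theta=\{te^{i\theta}:t\ge0\}$ and $\theta_j\in[0,2\pi)$, such that $\sigma\cap R_{\theta_j}$ is infinite for each $j$ and $\sigma\setminus(R_{\theta_1}\cup\dots\cup R_{\theta_k})$ is finite. **Corollary.** Any two $C$-sets are homeomorphic. Nevertheless, there are infinitely many mutually non-isomorphic Banach algebras $AC(\sigma)$ with $\sigma$ a $C$-set; more precisely, there is a sequence $\sigma_1,\sigma_2,\dots$ of $C$-sets such that $\sigma_k$ is a $k$-ray set for every $k\ge1$ and $AC(\sigma_k)$ and $AC(\sigma_l)$ are not isomorphic as Banach algebras whenever $k\ne l$. -/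

import Mathlib

open scoped ENNReal Topology

noncomputable section

/-- A line `a x + b y = c`, `(a, b) ≠ (0, 0)`, in the plane `ℂ = ℝ²`. -/
structure PlaneLine where
  a : ℝ
  b : ℝ
  c : ℝ
  nondeg : a ≠ 0 ∨ b ≠ 0

namespace PlaneLine

/-- The affine function `a x + b y - c`, which vanishes exactly on the line. -/
def eval (l : PlaneLine) (z : ℂ) : ℝ := l.a * z.re + l.b * z.im - l.c

/-- The point `z` lies on the line. -/
def On (l : PlaneLine) (z : ℂ) : Prop := l.eval z = 0

/-- The points `z` and `w` lie on strictly opposite sides of the line. -/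
def Opposite (l : PlaneLine) (z w : ℂ) : Prop := l.eval z * l.eval w < 0

end PlaneLine

/-- `[x i, x (i+1)]` (with `i < n`) is a crossing segment of the list `[x 0, …, x n]` on `l`.
Finite lists are given as the first `n + 1` terms of a sequence; later terms play no role. -/
def IsCrossing (n : ℕ) (x : ℕ → ℂ) (l : PlaneLine) (i : ℕ) : Prop :=
  l.Opposite (x i) (x (i + 1)) ∨
  (i = 0 ∧ l.On (x i)) ∨
  (0 < i ∧ l.On (x i) ∧ ¬ l.On (x (i - 1))) ∨
  (i + 1 = n ∧ ¬ l.On (x i) ∧ l.On (x (i + 1)))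

open Classical in
/-- `vf(S, l)`: the number of crossing segments of `S = [x 0, …, x n]` on `l`, with the convention
that a one-point list has `vf([x 0], l) = 1` if `x 0` is on `l` (and `0` otherwise). -/
def vfLine (n : ℕ) (x : ℕ → ℂ) (l : PlaneLine) : ℕ :=
  if n = 0 then (if l.On (x 0) then 1 else 0)
  else ((Finset.range n).filter fun i => IsCrossing n x l i).card

/-- The variation factor `vf(S)`: the maximum of `vf(S, l)` over all lines `l`. -/
def vf (n : ℕ) (x : ℕ → ℂ) : ℕ := ⨆ l : PlaneLine, vfLine n x l

theorem vfLine_le (n : ℕ) (x : ℕ → ℂ) (l : PlaneLine) : vfLine n x l ≤ max 1 n := by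
  unfold vfLine
  split_ifs
  · simp
  · simp
  · classical
    refine (Finset.card_filter_le _ _).trans ?_
    simp

theorem vfLine_le_vf (n : ℕ) (x : ℕ → ℂ) (l : PlaneLine) : vfLine n x l ≤ vf n x :=
  le_ciSup (f := fun l => vfLine n x l)
    ⟨max 1 n, by rintro _ ⟨l, rfl⟩; exact vfLine_le n x l⟩ l

theorem one_le_vf (n : ℕ) (x : ℕ → ℂ) : 1 ≤ vf n x := by
  let l : PlaneLine := ⟨1, 0, (x 0).re, Or.inl one_ne_zero⟩
  have hl : l.On (x 0) := by simp [l, PlaneLine.On, PlaneLine.eval]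
  refine le_trans ?_ (vfLine_le_vf n x l)
  unfold vfLine
  split_ifs with h
  · exact le_rfl
  · exact Finset.card_pos.mpr ⟨0, by
      simp only [Finset.mem_filter, Finset.mem_range]
      exact ⟨Nat.pos_of_ne_zero h, Or.inr (Or.inl ⟨rfl, hl⟩)⟩⟩

section Spaces

variable {σ : Set ℂ}

/-- The curve variation `∑ |f (x i) - f (x (i-1))|` of `f` on the list `[x 0, …, x n]` in `σ`. -/
def cvar (f : σ → ℂ) (n : ℕ) (x : ℕ → σ) : ℝ≥0∞ :=
  ∑ i ∈ Finset.range n, ‖f (x (i + 1)) - f (x i)‖ₑ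

/-- The two-dimensional variation `var(f, σ)`: the supremum of `cvar(f, S) / vf(S)` over all finite
nonempty ordered lists `S` of elements of `σ`. -/
def var (f : σ → ℂ) : ℝ≥0∞ :=
  ⨆ (n : ℕ) (x : ℕ → σ), cvar f n x / (vf n (fun i => (x i : ℂ)) : ℝ≥0∞)

/-- The supremum norm of `f`, possibly infinite. -/
def supENorm (f : σ → ℂ) : ℝ≥0∞ := ⨆ z, ‖f z‖ₑ

/-- The variation norm `‖f‖_∞ + var(f, σ)`, possibly infinite. -/
def bvENorm (f : σ → ℂ) : ℝ≥0∞ := supENorm f + var f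

theorem enorm_le_supENorm (f : σ → ℂ) (z : σ) : ‖f z‖ₑ ≤ supENorm f :=
  le_iSup (fun z => ‖f z‖ₑ) z

theorem cvar_div_le_var (f : σ → ℂ) (n : ℕ) (x : ℕ → σ) :
    cvar f n x / (vf n (fun i => (x i : ℂ)) : ℝ≥0∞) ≤ var f :=
  le_iSup₂ (f := fun n (x : ℕ → σ) => cvar f n x / (vf n (fun i => (x i : ℂ)) : ℝ≥0∞)) n x

theorem enorm_le_bvENorm (f : σ → ℂ) (z : σ) : ‖f z‖ₑ ≤ bvENorm f :=
  (enorm_le_supENorm f z).trans le_self_add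

theorem bvENorm_const (c : ℂ) : bvENorm (fun _ : σ => c) ≤ ‖c‖ₑ := by
  have h : var (fun _ : σ => c) = 0 := by simp [var, cvar]
  rw [bvENorm, h, add_zero]
  exact iSup_le fun _ => le_rfl

theorem bvENorm_add (f g : σ → ℂ) : bvENorm (f + g) ≤ bvENorm f + bvENorm g := by
  have h1 : supENorm (f + g) ≤ supENorm f + supENorm g :=
    iSup_le fun z => (enorm_add_le _ _).trans
      (add_le_add (enorm_le_supENorm f z) (enorm_le_supENorm g z))
  have h2 : var (f + g) ≤ var f + var g := by
    refine iSup₂_le fun n x => ?_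
    have : cvar (f + g) n x ≤ cvar f n x + cvar g n x := by
      unfold cvar
      rw [← Finset.sum_add_distrib]
      refine Finset.sum_le_sum fun i _ => ?_
      rw [Pi.add_apply, Pi.add_apply, add_sub_add_comm]
      exact enorm_add_le _ _
    refine (ENNReal.div_le_div_right this _).trans ?_
    rw [ENNReal.add_div]
    exact add_le_add (cvar_div_le_var f n x) (cvar_div_le_var g n x)
  calc bvENorm (f + g) ≤ (supENorm f + supENorm g) + (var f + var g) := add_le_add h1 h2
    _ = bvENorm f + bvENorm g := add_add_add_comm _ _ _ _

theorem bvENorm_mul (f g : σ → ℂ) : bvENorm (f * g) ≤ bvENorm f * bvENorm g := by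
  have h1 : supENorm (f * g) ≤ supENorm f * supENorm g :=
    iSup_le fun z => by
      rw [Pi.mul_apply, enorm_mul]
      exact mul_le_mul' (enorm_le_supENorm f z) (enorm_le_supENorm g z)
  have h2 : var (f * g) ≤ supENorm f * var g + var f * supENorm g := by
    refine iSup₂_le fun n x => ?_
    have : cvar (f * g) n x ≤ supENorm f * cvar g n x + cvar f n x * supENorm g := by
      unfold cvar
      rw [Finset.mul_sum, Finset.sum_mul, ← Finset.sum_add_distrib]
      refine Finset.sum_le_sum fun i _ => ?_
      have e : (f * g) (x (i + 1)) - (f * g) (x i) =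
          f (x (i + 1)) * (g (x (i + 1)) - g (x i)) + (f (x (i + 1)) - f (x i)) * g (x i) := by
        simp only [Pi.mul_apply]; ring
      rw [e]
      refine (enorm_add_le _ _).trans ?_
      rw [enorm_mul, enorm_mul]
      gcongr
      · exact enorm_le_supENorm f _
      · exact enorm_le_supENorm g _
    refine (ENNReal.div_le_div_right this _).trans ?_
    rw [ENNReal.add_div, mul_div_assoc, mul_comm (cvar f n x), mul_div_assoc,
      mul_comm (var f)]
    gcongr
    · exact cvar_div_le_var g n x
    · exact cvar_div_le_var f n x
  calc bvENorm (f * g)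
      ≤ supENorm f * supENorm g + (supENorm f * var g + var f * supENorm g) := add_le_add h1 h2
    _ ≤ supENorm f * supENorm g + (supENorm f * var g + var f * supENorm g) + var f * var g :=
        le_self_add
    _ = bvENorm f * bvENorm g := by unfold bvENorm; ring

theorem bvENorm_neg (f : σ → ℂ) : bvENorm (-f) = bvENorm f := by
  have h : ∀ z w : ℂ, ‖-z - -w‖ₑ = ‖z - w‖ₑ := fun z w => by
    rw [← enorm_neg]; congr 1; ring
  simp only [bvENorm, supENorm, var, cvar, Pi.neg_apply, enorm_neg, h]

variable (σ) in
/-- The functions of bounded variation on `σ`, as a subalgebra of all functions `σ → ℂ` under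
pointwise operations. -/
def BVSubalgebra : Subalgebra ℂ (σ → ℂ) where
  carrier := {f | bvENorm f < ∞}
  mul_mem' := fun {f g} hf hg => (bvENorm_mul f g).trans_lt (ENNReal.mul_lt_top hf hg)
  add_mem' := fun {f g} hf hg => (bvENorm_add f g).trans_lt (ENNReal.add_lt_top.mpr ⟨hf, hg⟩)
  algebraMap_mem' := fun c => (bvENorm_const c).trans_lt enorm_lt_top

variable (σ) in
/-- The algebra `BV(σ)`. This is a type of its own, so that it carries the topology of the variation
norm and not that of pointwise convergence. -/
def BV : Type := BVSubalgebra σ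

namespace BV

instance : CommRing (BV σ) := inferInstanceAs (CommRing (BVSubalgebra σ))

instance : Algebra ℂ (BV σ) := inferInstanceAs (Algebra ℂ (BVSubalgebra σ))

variable (σ) in
/-- The inclusion of `BV(σ)` into the algebra of all functions on `σ`. -/
def toFun : BV σ →ₐ[ℂ] (σ → ℂ) := (BVSubalgebra σ).val

theorem toFun_injective : Function.Injective (toFun σ) := Subtype.val_injective

theorem bvENorm_ne_top (f : BV σ) : bvENorm (toFun σ f) ≠ ∞ := (Subtype.property f).ne

/-- The variation norm `‖f‖ = ‖f‖_∞ + var(f, σ)`. -/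
instance : Norm (BV σ) := ⟨fun f => (bvENorm (toFun σ f)).toReal⟩

theorem norm_def (f : BV σ) : ‖f‖ = (bvENorm (toFun σ f)).toReal := rfl

theorem norm_apply_le (f : BV σ) (z : σ) : ‖toFun σ f z‖ ≤ ‖f‖ := by
  rw [norm_def, ← toReal_enorm]
  exact ENNReal.toReal_mono (bvENorm_ne_top f) (enorm_le_bvENorm _ z)

instance : NormedCommRing (BV σ) :=
  { NormedAddCommGroup.ofCore (𝕜 := ℂ) (E := BV σ)
      { norm_nonneg := fun _ => ENNReal.toReal_nonneg
        norm_smul := by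
          have key : ∀ (c : ℂ) (f : BV σ), ‖c • f‖ ≤ ‖c‖ * ‖f‖ := fun c f => by
            have h : bvENorm (toFun σ (c • f)) ≤ ‖c‖ₑ * bvENorm (toFun σ f) := by
              have e : toFun σ (c • f) = (fun _ => c) * toFun σ f := by
                rw [map_smul]; rfl
              rw [e]
              exact (bvENorm_mul _ _).trans (mul_le_mul' (bvENorm_const c) le_rfl)
            rw [norm_def, norm_def, ← toReal_enorm, ← ENNReal.toReal_mul]
            exact ENNReal.toReal_mono
              (ENNReal.mul_ne_top enorm_ne_top (bvENorm_ne_top f)) h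
          intro c f
          refine le_antisymm (key c f) ?_
          by_cases hc : c = 0
          · subst hc
            rw [norm_zero, zero_mul]
            exact ENNReal.toReal_nonneg
          · have h := key c⁻¹ (c • f)
            rw [smul_smul, inv_mul_cancel₀ hc, one_smul, norm_inv] at h
            have hc' : 0 < ‖c‖ := norm_pos_iff.mpr hc
            calc ‖c‖ * ‖f‖ ≤ ‖c‖ * (‖c‖⁻¹ * ‖c • f‖) := by gcongr
              _ = ‖c • f‖ := by field_simp
        norm_triangle := fun f g => by
          rw [norm_def, norm_def, norm_def, map_add,
            ← ENNReal.toReal_add (bvENorm_ne_top f) (bvENorm_ne_top g)]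
          exact ENNReal.toReal_mono
            (ENNReal.add_ne_top.mpr ⟨bvENorm_ne_top f, bvENorm_ne_top g⟩) (bvENorm_add _ _)
        norm_eq_zero_iff := fun f => by
          constructor
          · intro h
            apply toFun_injective
            rw [map_zero]
            funext z
            exact norm_le_zero_iff.mp ((norm_apply_le f z).trans h.le)
          · rintro rfl
            have h : bvENorm (toFun σ (0 : BV σ)) ≤ ‖(0 : ℂ)‖ₑ := by
              rw [map_zero]; exact bvENorm_const 0
            rw [enorm_zero, nonpos_iff_eq_zero] at h
            rw [norm_def, h, ENNReal.toReal_zero] },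
    (inferInstance : CommRing (BV σ)) with
    norm_mul_le := fun f g => by
      show (bvENorm (toFun σ (f * g))).toReal ≤
        (bvENorm (toFun σ f)).toReal * (bvENorm (toFun σ g)).toReal
      rw [map_mul, ← ENNReal.toReal_mul]
      exact ENNReal.toReal_mono
        (ENNReal.mul_ne_top (bvENorm_ne_top f) (bvENorm_ne_top g)) (bvENorm_mul _ _) }

instance : NormedAlgebra ℂ (BV σ) where
  norm_smul_le := fun c f => by
    have e : toFun σ (c • f) = (fun _ => c) * toFun σ f := by
      rw [map_smul]; rfl
    rw [norm_def, norm_def, ← toReal_enorm, ← ENNReal.toReal_mul, e]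
    exact ENNReal.toReal_mono (ENNReal.mul_ne_top enorm_ne_top (bvENorm_ne_top f))
      ((bvENorm_mul _ _).trans (mul_le_mul' (bvENorm_const c) le_rfl))

end BV

theorem lowerSemicontinuous_bvENorm :
    LowerSemicontinuous (bvENorm : (σ → ℂ) → ℝ≥0∞) := by
  refine LowerSemicontinuous.add ?_ ?_
  · refine lowerSemicontinuous_iSup fun z => Continuous.lowerSemicontinuous ?_
    exact (continuous_apply (A := fun _ : σ => ℂ) z).enorm
  · refine lowerSemicontinuous_iSup fun n => lowerSemicontinuous_iSup fun x =>
      Continuous.lowerSemicontinuous ?_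
    have h0 : (vf n (fun i => (x i : ℂ)) : ℝ≥0∞) ≠ 0 := by
      have := one_le_vf n (fun i => (x i : ℂ))
      exact_mod_cast (by omega : vf n (fun i => (x i : ℂ)) ≠ 0)
    refine (ENNReal.continuous_div_const _ h0).comp ?_
    refine continuous_finsetSum _ fun i _ => ?_
    exact ((continuous_apply (A := fun _ : σ => ℂ) _).sub
      (continuous_apply (A := fun _ : σ => ℂ) _)).enorm

instance BV.instCompleteSpace : CompleteSpace (BV σ) := by
  refine Metric.complete_of_cauchySeq_tendsto fun u hu => ?_
  have hpt : ∀ z : σ, ∃ w, Filter.Tendsto (fun n => BV.toFun σ (u n) z) Filter.atTop (𝓝 w) := by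
    intro z
    refine cauchySeq_tendsto_of_complete ?_
    rw [Metric.cauchySeq_iff] at hu ⊢
    intro ε hε
    obtain ⟨N, hN⟩ := hu ε hε
    refine ⟨N, fun m hm n hn => lt_of_le_of_lt ?_ (hN m hm n hn)⟩
    rw [dist_eq_norm, dist_eq_norm]
    have h := BV.norm_apply_le (u m - u n) z
    rwa [map_sub] at h
  choose g hg using hpt
  have hlim : ∀ ε > 0, ∃ N, ∀ n ≥ N, bvENorm (BV.toFun σ (u n) - g) ≤ ENNReal.ofReal ε := by
    intro ε hε
    obtain ⟨N, hN⟩ := Metric.cauchySeq_iff.mp hu ε hε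
    refine ⟨N, fun n hn => ?_⟩
    have hcl : IsClosed {h : σ → ℂ | bvENorm h ≤ ENNReal.ofReal ε} :=
      lowerSemicontinuous_bvENorm.isClosed_preimage (ENNReal.ofReal ε)
    have ht : Filter.Tendsto (fun m => BV.toFun σ (u n) - BV.toFun σ (u m)) Filter.atTop
        (𝓝 (BV.toFun σ (u n) - g)) :=
      tendsto_pi_nhds.mpr fun z => (hg z).const_sub _
    refine hcl.mem_of_tendsto ht ?_
    filter_upwards [Filter.eventually_ge_atTop N] with m hm
    have h := (hN n hn m hm).le
    rw [dist_eq_norm, BV.norm_def, map_sub] at h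
    have hfin : bvENorm (BV.toFun σ (u n) - BV.toFun σ (u m)) ≠ ∞ := by
      rw [← map_sub]; exact BV.bvENorm_ne_top _
    exact (ENNReal.le_ofReal_iff_toReal_le hfin hε.le).mpr h
  have hmem : bvENorm g < ∞ := by
    obtain ⟨N, hN⟩ := hlim 1 one_pos
    have h := hN N le_rfl
    have e : g = BV.toFun σ (u N) + -(BV.toFun σ (u N) - g) := by abel
    rw [e]
    refine (bvENorm_add _ _).trans_lt (ENNReal.add_lt_top.mpr
      ⟨(BV.bvENorm_ne_top _).lt_top, ?_⟩)
    rw [bvENorm_neg]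
    exact h.trans_lt ENNReal.ofReal_lt_top
  let G : BV σ := (⟨g, hmem⟩ : BVSubalgebra σ)
  refine ⟨G, Metric.tendsto_atTop.mpr fun ε hε => ?_⟩
  obtain ⟨N, hN⟩ := hlim (ε / 2) (half_pos hε)
  refine ⟨N, fun n hn => ?_⟩
  rw [dist_eq_norm, BV.norm_def, map_sub]
  have h : (bvENorm (BV.toFun σ (u n) - g)).toReal ≤ ε / 2 :=
    ENNReal.toReal_le_of_le_ofReal (half_pos hε).le (hN n hn)
  exact lt_of_le_of_lt h (half_lt_self hε)

variable (σ) in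
/-- `P₂(σ)`: restrictions to `σ` of the polynomials `∑ c_{nm} xⁿ yᵐ` (with complex coefficients) in
the two real variables `x = re z`, `y = im z`. -/
def Pol₂ : Subalgebra ℂ (σ → ℂ) :=
  (MvPolynomial.aeval (R := ℂ)
    ![fun z : σ => ((z : ℂ).re : ℂ), fun z : σ => ((z : ℂ).im : ℂ)]).range

variable (σ) in
/-- `AC(σ)`: the closure of `P₂(σ)`, regarded as a set of elements of `BV(σ)`, in the Banach algebra
`BV(σ)`. -/
def AC : Subalgebra ℂ (BV σ) := ((Pol₂ σ).comap (BV.toFun σ)).topologicalClosure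

/-- `AC(σ)` is a Banach algebra. -/
instance AC.instCompleteSpace : CompleteSpace (AC σ) :=
  (Subalgebra.isClosed_topologicalClosure _).completeSpace_coe

end Spaces

/-- A `C`-set: a countably infinite compact subset of the plane whose unique limit point is `0`. -/
structure IsCSet (σ : Set ℂ) : Prop where
  countable : σ.Countable
  infinite : σ.Infinite
  isCompact : IsCompact σ
  limitPoints : derivedSet σ = {0}

/-- The ray `R_θ = {t e^{iθ} : t ≥ 0}`. -/
def ray (θ : ℝ) : Set ℂ := {z | ∃ t : ℝ, 0 ≤ t ∧ z = t * Complex.exp (θ * Complex.I)}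

/-- A `k`-ray set: a `C`-set meeting each of some `k ≥ 1` distinct rays from the origin in an
infinite set, and having only finitely many points off these rays. -/
structure IsRaySet (k : ℕ) (σ : Set ℂ) : Prop where
  isCSet : IsCSet σ
  pos : 0 < k
  exists_rays : ∃ θ : Fin k → ℝ, (∀ j, θ j ∈ Set.Ico 0 (2 * Real.pi)) ∧ Function.Injective θ ∧
    (∀ j, (σ ∩ ray (θ j)).Infinite) ∧ (σ \ ⋃ j, ray (θ j)).Finite

end

/-- A `C`-set is the one-point compactification of a countable discrete space. -/
theorem IsCSet.nonempty_homeomorph {σ : Set ℂ} (h : IsCSet σ) :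
    Nonempty (OnePoint ℕ ≃ₜ σ) := by
  have h0 : (0 : ℂ) ∈ σ :=
    (isClosed_iff_derivedSet_subset σ).mp h.isCompact.isClosed (h.limitPoints ▸ rfl)
  have hd : DiscreteTopology ↥(σ \ {0}) := by
    refine discreteTopology_of_noAccPts fun z hz hacc => hz.2 ?_
    have : z ∈ derivedSet σ := derivedSet_mono _ _ Set.sdiff_subset hacc
    rwa [h.limitPoints] at this
  have : CompactSpace σ := isCompact_iff_compactSpace.mp h.isCompact
  have : Countable ↥(σ \ {0}) := (h.countable.mono Set.sdiff_subset).to_subtype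
  have : Infinite ↥(σ \ {0}) := (h.infinite.sdiff (Set.finite_singleton 0)).to_subtype
  obtain ⟨e⟩ := nonempty_equiv_of_countable (α := ℕ) (β := ↥(σ \ {0}))
  have hinc : Topology.IsEmbedding (Set.inclusion (Set.sdiff_subset : σ \ {0} ⊆ σ)) :=
    Topology.IsEmbedding.inclusion _
  refine ⟨OnePoint.equivOfIsEmbeddingOfRangeEq (⟨0, h0⟩ : σ)
    (Set.inclusion Set.sdiff_subset ∘ e.toHomeomorphOfDiscrete)
    (hinc.comp e.toHomeomorphOfDiscrete.isEmbedding) ?_⟩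
  rw [Set.range_comp, e.toHomeomorphOfDiscrete.range_coe, Set.image_univ, Set.range_inclusion]
  ext z
  simp [Subtype.ext_iff]

/-! ### The model ray sets -/

/-- The point with parameter `1 / (i + 1)` on the ray of slope `j`. -/
noncomputable def slopePt (j i : ℕ) : ℂ := ⟨1 / (i + 1), j / (i + 1)⟩

theorem slopePt_re (j i : ℕ) : (slopePt j i).re = 1 / (i + 1) := rfl

theorem slopePt_im (j i : ℕ) : (slopePt j i).im = j / (i + 1) := rfl

theorem slopePt_re_pos (j i : ℕ) : 0 < (slopePt j i).re := by
  rw [slopePt_re]; positivity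

theorem slopePt_ne_zero (j i : ℕ) : slopePt j i ≠ 0 := fun h => by
  have := slopePt_re_pos j i
  simp [h] at this

theorem slopePt_injective (j : ℕ) : Function.Injective (slopePt j) := fun i i' h => by
  have := congrArg Complex.re h
  simpa [slopePt_re] using this

theorem norm_slopePt_le (j i : ℕ) : ‖slopePt j i‖ ≤ (1 + j) / (i + 1) := by
  refine (Complex.norm_le_abs_re_add_abs_im _).trans ?_
  rw [slopePt_re, slopePt_im, abs_of_nonneg (by positivity), abs_of_nonneg (by positivity), add_div]

theorem tendsto_slopePt (j : ℕ) : Filter.Tendsto (slopePt j) Filter.atTop (𝓝 0) := by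
  refine squeeze_zero_norm (norm_slopePt_le j) ?_
  simpa [div_eq_mul_inv] using
    (tendsto_one_div_add_atTop_nhds_zero_nat (𝕜 := ℝ)).const_mul (1 + (j : ℝ))

/-- The set made of `0` and of the points `1 / (i + 1)` on the rays of slopes `0, …, k`. -/
def slopeSet (k : ℕ) : Set ℂ := ⋃ j : Fin (k + 1), insert 0 (Set.range (slopePt j))

theorem slopePt_mem {j k : ℕ} (h : j ≤ k) (i : ℕ) : slopePt j i ∈ slopeSet k :=
  Set.mem_iUnion.mpr ⟨⟨j, Nat.lt_succ_of_le h⟩, Or.inr ⟨i, rfl⟩⟩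

theorem mem_slopeSet {k : ℕ} {z : ℂ} :
    z ∈ slopeSet k ↔ z = 0 ∨ ∃ j ≤ k, ∃ i, z = slopePt j i := by
  constructor
  · intro h
    obtain ⟨j, h | ⟨i, rfl⟩⟩ := Set.mem_iUnion.mp h
    · exact Or.inl h
    · exact Or.inr ⟨j, Nat.le_of_lt_succ j.2, i, rfl⟩
  · rintro (rfl | ⟨j, hj, i, rfl⟩)
    · exact Set.mem_iUnion.mpr ⟨0, Or.inl rfl⟩
    · exact slopePt_mem hj i

theorem finite_slopeSet_norm_gt (k : ℕ) {r : ℝ} (hr : 0 < r) :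
    {z ∈ slopeSet k | r < ‖z‖}.Finite := by
  obtain ⟨M, hM⟩ := exists_nat_gt ((1 + k) / r)
  refine ((Set.finite_Iic k).image2 slopePt (Set.finite_Iio M)).subset ?_
  rintro z ⟨hz, hzr⟩
  obtain rfl | ⟨j, hj, i, rfl⟩ := mem_slopeSet.mp hz
  · simp at hzr; linarith
  · refine ⟨j, hj, i, ?_, rfl⟩
    have h1 := hzr.trans_le (norm_slopePt_le j i)
    rw [lt_div_iff₀ (by positivity)] at h1
    rw [div_lt_iff₀ hr] at hM
    have h2 : (j : ℝ) ≤ k := by exact_mod_cast hj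
    have h3 : ((i : ℝ) + 1) * r < M * r := by linarith
    have h4 := lt_of_mul_lt_mul_right h3 hr.le
    have : i + 1 < M := by exact_mod_cast h4
    show i < M
    omega

theorem isCSet_slopeSet (k : ℕ) : IsCSet (slopeSet k) := by
  have hinf : (slopeSet k).Infinite :=
    (Set.infinite_range_of_injective (slopePt_injective 0)).mono
      (by rintro _ ⟨i, rfl⟩; exact slopePt_mem (Nat.zero_le k) i)
  have hc : IsCompact (slopeSet k) :=
    isCompact_iUnion fun j => (tendsto_slopePt j).isCompact_insert_range
  have hsub : derivedSet (slopeSet k) ⊆ {0} := by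
    intro z hz
    by_contra hz0
    have hz0 : 0 < ‖z‖ := norm_pos_iff.mpr hz0
    have hU : {w : ℂ | ‖z‖ / 2 < ‖w‖} ∈ 𝓝 z :=
      (isOpen_lt continuous_const continuous_norm).mem_nhds (half_lt_self hz0)
    refine Set.Infinite.of_accPt (AccPt.nhds_inter hz hU)
      ((finite_slopeSet_norm_gt k (half_pos hz0)).subset ?_)
    rintro w ⟨h1, h2⟩
    exact ⟨h2, h1⟩
  refine ⟨Set.countable_iUnion fun j => (Set.countable_range _).insert _, hinf, hc,
    hsub.antisymm ?_⟩
  obtain ⟨z, -, hz⟩ := hinf.exists_accPt_of_subset_isCompact hc subset_rfl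
  have : z = 0 := hsub hz
  exact Set.singleton_subset_iff.mpr (this ▸ hz)

theorem slopePt_mem_ray (j i : ℕ) : slopePt j i ∈ ray (Real.arctan j) := by
  -- The parameter is the modulus of the point: the cosine of `arctan j` is `1 / √(1 + j ^ 2)`.
  refine ⟨√(1 + (j : ℝ) ^ 2) / (i + 1), by positivity, ?_⟩
  have h : √(1 + (j : ℝ) ^ 2) ≠ 0 := by positivity
  have h2 : ((i : ℝ) + 1) ≠ 0 := by positivity
  rw [Complex.exp_mul_I, ← Complex.ofReal_cos, ← Complex.ofReal_sin, Real.cos_arctan,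
    Real.sin_arctan]
  apply Complex.ext
  · simp only [Complex.re_ofReal_mul, Complex.add_re, Complex.ofReal_re, Complex.mul_I_re,
      Complex.ofReal_im, slopePt_re]
    field_simp
    ring
  · simp only [Complex.im_ofReal_mul, Complex.add_im, Complex.ofReal_re, Complex.mul_I_im,
      Complex.ofReal_im, slopePt_im]
    field_simp
    ring

theorem isRaySet_slopeSet (k : ℕ) : IsRaySet (k + 1) (slopeSet k) := by
  refine ⟨isCSet_slopeSet k, k.succ_pos, fun j => Real.arctan (j : ℕ), fun j => ⟨?_, ?_⟩, ?_,
    fun j => ?_, ?_⟩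
  · exact Real.arctan_nonneg.mpr (Nat.cast_nonneg _)
  · have h1 := Real.arctan_lt_pi_div_two ((j : ℕ) : ℝ)
    have h2 := Real.pi_pos
    linarith
  · intro j j' h
    have := Real.arctan_injective h
    exact Fin.ext (by exact_mod_cast this)
  · refine (Set.infinite_range_of_injective (slopePt_injective j)).mono ?_
    rintro _ ⟨i, rfl⟩
    exact ⟨slopePt_mem (Nat.le_of_lt_succ j.2) i, slopePt_mem_ray j i⟩
  · refine (Set.finite_singleton (0 : ℂ)).subset ?_
    rintro z ⟨hz, hn⟩
    obtain rfl | ⟨j, hj, i, rfl⟩ := mem_slopeSet.mp hz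
    · rfl
    · exact absurd (Set.mem_iUnion.mpr ⟨(⟨j, Nat.lt_succ_of_le hj⟩ : Fin (k + 1)),
        slopePt_mem_ray j i⟩) hn

/-! ### Variation of functions of one linear form -/

/-- Banach indicatrix argument: an increment of the linear form is the length of the set of levels
`t` strictly between its endpoint values, and for each such `t` the segment crosses the level line
`a x + b y = t`. At most `vf` segments cross any one line; integrate over `t` in `[p, q]`. -/
theorem sum_abs_sub_le_vf {a b : ℝ} (hab : a ≠ 0 ∨ b ≠ 0) {p q : ℝ} (n : ℕ) (x : ℕ → ℂ)
    (hx : ∀ i, a * (x i).re + b * (x i).im ∈ Set.Icc p q) :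
    ∑ i ∈ Finset.range n, ENNReal.ofReal |(a * (x (i + 1)).re + b * (x (i + 1)).im) -
      (a * (x i).re + b * (x i).im)| ≤ vf n x * ENNReal.ofReal (q - p) := by
  classical
  set u : ℕ → ℝ := fun i => a * (x i).re + b * (x i).im with hu
  -- Open intervals keep both endpoints off the level line, so only the "strictly opposite sides"
  -- clause of `IsCrossing` is needed.
  let I : ℕ → Set ℝ := fun i => Set.Ioo (min (u i) (u (i + 1))) (max (u i) (u (i + 1)))
  have hI : ∀ i, MeasurableSet (I i) := fun i => measurableSet_Ioo
  have hvol : ∀ i, ENNReal.ofReal |u (i + 1) - u i| = ∫⁻ t, (I i).indicator 1 t := fun i => by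
    rw [MeasureTheory.lintegral_indicator_one (hI i), Real.volume_Ioo, max_sub_min_eq_abs]
  have hcount : ∀ t, ∑ i ∈ Finset.range n, (I i).indicator (1 : ℝ → ℝ≥0∞) t ≤
      (Set.Icc p q).indicator (fun _ => (vf n x : ℝ≥0∞)) t := by
    intro t
    by_cases ht : t ∈ Set.Icc p q
    · rw [Set.indicator_of_mem ht]
      simp only [Set.indicator_apply, Pi.one_apply]
      rw [Finset.sum_boole]
      rcases Nat.eq_zero_or_pos n with rfl | hn
      · simp
      · refine Nat.cast_le.mpr (le_trans ?_ (vfLine_le_vf n x ⟨a, b, t, hab⟩))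
        rw [vfLine, if_neg hn.ne']
        refine Finset.card_le_card fun i hi => ?_
        rw [Finset.mem_filter] at hi ⊢
        refine ⟨hi.1, Or.inl ?_⟩
        obtain ⟨h1, h2⟩ := hi.2
        show (u i - t) * (u (i + 1) - t) < 0
        rcases le_total (u i) (u (i + 1)) with h | h
        · rw [min_eq_left h] at h1
          rw [max_eq_right h] at h2
          exact mul_neg_of_neg_of_pos (by linarith) (by linarith)
        · rw [min_eq_right h] at h1
          rw [max_eq_left h] at h2
          exact mul_neg_of_pos_of_neg (by linarith) (by linarith)
    · rw [Set.indicator_of_notMem ht]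
      refine (Finset.sum_eq_zero fun i _ => Set.indicator_of_notMem (fun h => ht ?_) _).le
      exact ⟨(le_min (hx i).1 (hx (i + 1)).1).trans h.1.le,
        h.2.le.trans (max_le (hx i).2 (hx (i + 1)).2)⟩
  calc ∑ i ∈ Finset.range n, ENNReal.ofReal |u (i + 1) - u i|
      = ∫⁻ t, ∑ i ∈ Finset.range n, (I i).indicator 1 t := by
        rw [MeasureTheory.lintegral_finsetSum _ fun i _ => measurable_one.indicator (hI i)]
        exact Finset.sum_congr rfl fun i _ => hvol i
    _ ≤ ∫⁻ t, (Set.Icc p q).indicator (fun _ => (vf n x : ℝ≥0∞)) t :=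
        MeasureTheory.lintegral_mono hcount
    _ = vf n x * ENNReal.ofReal (q - p) := by
        rw [MeasureTheory.lintegral_indicator_const measurableSet_Icc, Real.volume_Icc]

/-! ### Continuously differentiable functions of a linear form belong to `AC` -/

section Approximation

variable {σ : Set ℂ}

theorem bvENorm_le_of_lipschitz {a b : ℝ} (hab : a ≠ 0 ∨ b ≠ 0) {p q : ℝ}
    (hσ : ∀ z ∈ σ, a * z.re + b * z.im ∈ Set.Icc p q) {f : σ → ℂ} {B L : ℝ} (hL : 0 ≤ L)
    (hB : ∀ z, ‖f z‖ ≤ B)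
    (hf : ∀ z w : σ, ‖f w - f z‖ ≤
      L * |(a * (w : ℂ).re + b * (w : ℂ).im) - (a * (z : ℂ).re + b * (z : ℂ).im)|) :
    bvENorm f ≤ ENNReal.ofReal B + ENNReal.ofReal L * ENNReal.ofReal (q - p) := by
  refine add_le_add (iSup_le fun z => ?_) (iSup₂_le fun n x => ?_)
  · rw [← ofReal_norm]
    exact ENNReal.ofReal_le_ofReal (hB z)
  · refine ENNReal.div_le_of_le_mul ?_
    calc cvar f n x
        ≤ ∑ i ∈ Finset.range n, ENNReal.ofReal L *
            ENNReal.ofReal |(a * (x (i + 1) : ℂ).re + b * (x (i + 1) : ℂ).im) -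
              (a * (x i : ℂ).re + b * (x i : ℂ).im)| := by
          refine Finset.sum_le_sum fun i _ => ?_
          rw [← ofReal_norm, ← ENNReal.ofReal_mul hL]
          exact ENNReal.ofReal_le_ofReal (hf _ _)
      _ ≤ ENNReal.ofReal L * (vf n (fun i => (x i : ℂ)) * ENNReal.ofReal (q - p)) := by
          rw [← Finset.mul_sum]
          gcongr
          exact sum_abs_sub_le_vf hab n (fun i => (x i : ℂ)) fun i => hσ _ (x i).2
      _ = ENNReal.ofReal L * ENNReal.ofReal (q - p) * vf n (fun i => (x i : ℂ)) := by ring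

theorem bvENorm_comp_le {a b : ℝ} (hab : a ≠ 0 ∨ b ≠ 0) {p q : ℝ}
    (hσ : ∀ z ∈ σ, a * z.re + b * z.im ∈ Set.Icc p q) {g : ℝ → ℝ} (hg : Differentiable ℝ g)
    {B L : ℝ} (hL : 0 ≤ L) (hB : ∀ t ∈ Set.Icc p q, |g t| ≤ B)
    (hd : ∀ t ∈ Set.Icc p q, |deriv g t| ≤ L) :
    bvENorm (fun z : σ => (g (a * (z : ℂ).re + b * (z : ℂ).im) : ℂ)) ≤
      ENNReal.ofReal B + ENNReal.ofReal L * ENNReal.ofReal (q - p) := by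
  refine bvENorm_le_of_lipschitz hab hσ hL (fun z => ?_) fun z w => ?_
  · rw [Complex.norm_real]
    exact hB _ (hσ _ z.2)
  · rw [← Complex.ofReal_sub, Complex.norm_real]
    exact (convex_Icc p q).norm_image_sub_le_of_norm_deriv_le (fun t _ => hg t) hd
      (hσ _ z.2) (hσ _ w.2)

theorem exists_derivative_eq (Q : Polynomial ℝ) : ∃ P : Polynomial ℝ, P.derivative = Q := by
  induction Q using Polynomial.induction_on' with
  | add Q₁ Q₂ h₁ h₂ =>
    obtain ⟨P₁, rfl⟩ := h₁
    obtain ⟨P₂, rfl⟩ := h₂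
    exact ⟨P₁ + P₂, Polynomial.derivative_add⟩
  | monomial n c =>
    refine ⟨Polynomial.monomial (n + 1) (c / (n + 1)), ?_⟩
    rw [Polynomial.derivative_monomial]
    have h : (n : ℝ) + 1 ≠ 0 := by positivity
    push_cast
    rw [div_mul_cancel₀ _ h]

theorem polynomial_comp_mem_Pol₂ (a b : ℝ) (P : Polynomial ℝ) :
    (fun z : σ => ((P.eval (a * (z : ℂ).re + b * (z : ℂ).im) : ℝ) : ℂ)) ∈ Pol₂ σ := by
  have hre : (fun z : σ => ((z : ℂ).re : ℂ)) ∈ Pol₂ σ := ⟨MvPolynomial.X 0, by simp⟩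
  have him : (fun z : σ => ((z : ℂ).im : ℂ)) ∈ Pol₂ σ := ⟨MvPolynomial.X 1, by simp⟩
  have hu := (Pol₂ σ).add_mem ((Pol₂ σ).smul_mem hre (a : ℂ)) ((Pol₂ σ).smul_mem him (b : ℂ))
  have h := (Polynomial.aeval (⟨_, hu⟩ : Pol₂ σ) (P.map Complex.ofRealHom)).2
  -- The inclusion of `Pol₂ σ` and evaluation at a point are algebra homomorphisms, so both commute
  -- with `aeval`.
  rw [← Subalgebra.coe_val, ← Polynomial.aeval_algHom_apply] at h
  convert h using 1
  funext z
  rw [← Pi.evalAlgHom_apply (R := ℂ) (A := fun _ : σ => ℂ) z (Polynomial.aeval _ _),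
    ← Polynomial.aeval_algHom_apply, Polynomial.aeval_def, Polynomial.eval₂_map]
  have e : Pi.evalAlgHom ℂ (fun _ : σ => ℂ) z ((Pol₂ σ).val ⟨_, hu⟩) =
      Complex.ofRealHom (a * (z : ℂ).re + b * (z : ℂ).im) := by
    simp
  rw [e]
  exact (Polynomial.hom_eval₂ P (RingHom.id ℝ) Complex.ofRealHom _).trans rfl

/-- That `F` has bounded variation need not be assumed: it follows from a single approximant, the
one for `ε = 1`. -/
theorem exists_AC_toFun_eq {F : σ → ℂ}
    (h : ∀ ε > 0, ∃ P ∈ Pol₂ σ, bvENorm P < ∞ ∧ bvENorm (F - P) ≤ ENNReal.ofReal ε) :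
    ∃ f : AC σ, BV.toFun σ f = F := by
  have hF : bvENorm F < ∞ := by
    obtain ⟨P, -, h1, h2⟩ := h 1 one_pos
    rw [← add_sub_cancel P F]
    exact (bvENorm_add _ _).trans_lt
      (ENNReal.add_lt_top.mpr ⟨h1, h2.trans_lt ENNReal.ofReal_lt_top⟩)
  let G : BV σ := (⟨F, hF⟩ : BVSubalgebra σ)
  have hG : BV.toFun σ G = F := rfl
  refine ⟨⟨G, Metric.mem_closure_iff.mpr fun ε hε => ?_⟩, hG⟩
  obtain ⟨P, hP, h1, h2⟩ := h (ε / 2) (half_pos hε)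
  let P' : BV σ := (⟨P, h1⟩ : BVSubalgebra σ)
  have hP' : BV.toFun σ P' = P := rfl
  refine ⟨P', hP, ?_⟩
  rw [dist_eq_norm, BV.norm_def, map_sub, hG, hP']
  exact (ENNReal.toReal_le_of_le_ofReal (half_pos hε).le h2).trans_lt (half_lt_self hε)

/-- `AC(σ)` contains the compositions of continuously differentiable functions of one variable with
real linear forms. -/
theorem exists_AC_toFun_comp {a b : ℝ} (hab : a ≠ 0 ∨ b ≠ 0) {p q : ℝ} (hpq : p < q)
    (hσ : ∀ z ∈ σ, a * z.re + b * z.im ∈ Set.Icc p q) {g : ℝ → ℝ} (hg : ContDiff ℝ 1 g) :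
    ∃ f : AC σ, ∀ z, BV.toFun σ f z = g (a * (z : ℂ).re + b * (z : ℂ).im) := by
  suffices h : ∃ f : AC σ, BV.toFun σ f =
      fun z : σ => (g (a * (z : ℂ).re + b * (z : ℂ).im) : ℂ) by
    obtain ⟨f, hf⟩ := h
    exact ⟨f, fun z => congrFun hf z⟩
  refine exists_AC_toFun_eq fun ε hε => ?_
  have hpq' : 0 < q - p := sub_pos.mpr hpq
  -- Approximating `deriv g` and integrating controls the Lipschitz constant of the error, hence its
  -- variation. With this `δ`, the supremum and the variation of the error each cost at most `δ * (q
  -- - p) = ε / 2`.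
  set δ := ε / (2 * (q - p)) with hδ
  have hδ0 : 0 < δ := by positivity
  obtain ⟨Q, hQ⟩ := exists_polynomial_near_of_continuousOn p q (deriv g)
    (hg.continuous_deriv le_rfl).continuousOn δ hδ0
  obtain ⟨P₀, hP₀⟩ := exists_derivative_eq Q
  -- The constant makes `P` agree with `g` at `p`, so the derivative bound also controls the
  -- supremum of `g - P`.
  let P : Polynomial ℝ := P₀ + Polynomial.C (g p - P₀.eval p)
  have hPp : P.eval p = g p := by simp [P]
  have hPd : P.derivative = Q := by simp [P, hP₀]
  have hgd : Differentiable ℝ g := hg.differentiable one_ne_zero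
  have hd : Differentiable ℝ fun t => g t - P.eval t := hgd.sub P.differentiable
  have hdd : ∀ t ∈ Set.Icc p q, |deriv (fun t => g t - P.eval t) t| ≤ δ := fun t ht => by
    rw [deriv_fun_sub (hgd t) P.differentiableAt, Polynomial.deriv, hPd, abs_sub_comm]
    exact (hQ t ht).le
  refine ⟨_, polynomial_comp_mem_Pol₂ a b P, ?_, ?_⟩
  · obtain ⟨B, hB⟩ := isCompact_Icc.exists_bound_of_continuousOn
      (P.continuous.continuousOn (s := Set.Icc p q))
    obtain ⟨L, hL⟩ := isCompact_Icc.exists_bound_of_continuousOn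
      (Q.continuous.continuousOn (s := Set.Icc p q))
    refine (bvENorm_comp_le (L := L) hab hσ P.differentiable ?_ hB fun t ht => ?_).trans_lt
      (ENNReal.add_lt_top.mpr ⟨ENNReal.ofReal_lt_top,
        ENNReal.mul_lt_top ENNReal.ofReal_lt_top ENNReal.ofReal_lt_top⟩)
    · exact (norm_nonneg _).trans (hL p (Set.left_mem_Icc.mpr hpq.le))
    · rw [Polynomial.deriv, hPd]
      exact hL t ht
  · have e : (fun z : σ => (g (a * (z : ℂ).re + b * (z : ℂ).im) : ℂ)) -
        (fun z : σ => ((P.eval (a * (z : ℂ).re + b * (z : ℂ).im) : ℝ) : ℂ)) =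
        fun z : σ => (((fun t => g t - P.eval t) (a * (z : ℂ).re + b * (z : ℂ).im) : ℝ) : ℂ) := by
      funext z
      simp
    rw [e]
    refine (bvENorm_comp_le (B := ε / 2) hab hσ hd hδ0.le (fun t ht => ?_) hdd).trans ?_
    · have h := (convex_Icc p q).norm_image_sub_le_of_norm_deriv_le (fun t _ => hd t) hdd
        (Set.left_mem_Icc.mpr hpq.le) ht
      simp only [hPp, sub_self, sub_zero, Real.norm_eq_abs] at h
      refine h.trans ?_
      rw [abs_of_nonneg (sub_nonneg.mpr ht.1)]
      calc δ * (t - p) ≤ δ * (q - p) := by gcongr; exact ht.2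
        _ = ε / 2 := by rw [hδ]; field_simp
    · rw [← ENNReal.ofReal_mul hδ0.le, ← ENNReal.ofReal_add (by positivity) (by positivity)]
      refine ENNReal.ofReal_le_ofReal (le_of_eq ?_)
      rw [hδ]
      field_simp
      ring

end Approximation

/-! ### Block idempotents and separating lines -/

/-- Each jump of a `0`-`1` function has size one and crosses at least one of the given lines, while
each line is crossed at most `vf` times. -/
theorem bvENorm_le_of_separated {σ : Set ℂ} {ι : Type*} [Fintype ι] (l : ι → PlaneLine)
    {f : σ → ℂ} (h01 : ∀ z, f z = 0 ∨ f z = 1)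
    (hsep : ∀ z w : σ, f z = 0 → f w = 1 → ∃ s, (l s).Opposite z w) :
    bvENorm f ≤ 1 + Fintype.card ι := by
  classical
  refine add_le_add (iSup_le fun z => ?_) (iSup₂_le fun n x => ?_)
  · rcases h01 z with h | h <;> simp [h]
  refine ENNReal.div_le_of_le_mul ?_
  have key : ∀ z w : σ, ‖f w - f z‖ₑ ≤
      ∑ s, if (l s).Opposite z w then (1 : ℝ≥0∞) else 0 := by
    intro z w
    have hone : ∀ s, (l s).Opposite z w →
        1 ≤ ∑ s, if (l s).Opposite z w then (1 : ℝ≥0∞) else 0 := fun s hs => by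
      refine le_trans ?_ (Finset.single_le_sum (fun _ _ => zero_le) (Finset.mem_univ s))
      rw [if_pos hs]
    rcases h01 z with hz | hz <;> rcases h01 w with hw | hw
    · simp [hz, hw]
    · obtain ⟨s, hs⟩ := hsep z w hz hw
      simpa [hz, hw] using hone s hs
    · obtain ⟨s, hs⟩ := hsep w z hw hz
      rw [PlaneLine.Opposite, mul_comm] at hs
      simpa [hz, hw] using hone s hs
    · simp [hz, hw]
  calc cvar f n x
      ≤ ∑ i ∈ Finset.range n, ∑ s,
          if (l s).Opposite (x i) (x (i + 1)) then (1 : ℝ≥0∞) else 0 :=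
        Finset.sum_le_sum fun i _ => key _ _
    _ ≤ ∑ _s : ι, (vf n (fun i => (x i : ℂ)) : ℝ≥0∞) := by
        rw [Finset.sum_comm]
        refine Finset.sum_le_sum fun s _ => ?_
        rw [Finset.sum_boole]
        rcases Nat.eq_zero_or_pos n with rfl | hn
        · simp
        · refine Nat.cast_le.mpr (le_trans ?_ (vfLine_le_vf n _ (l s)))
          rw [vfLine, if_neg hn.ne']
          exact Finset.card_le_card fun i hi => by
            rw [Finset.mem_filter] at hi ⊢
            exact ⟨hi.1, Or.inl hi.2⟩
    _ = Fintype.card ι * vf n (fun i => (x i : ℂ)) := by simp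

/-- The first `N + 1` points on the ray of slope `j`. -/
def slopeBlock (j N : ℕ) : Set ℂ := slopePt j '' Set.Iic N

theorem slopePt_mem_slopeBlock {j j' i N : ℕ} :
    slopePt j' i ∈ slopeBlock j N ↔ j' = j ∧ i ≤ N := by
  constructor
  · rintro ⟨i', hi', h⟩
    have h1 : i' = i := by
      have := congrArg Complex.re h
      simpa [slopePt_re] using this
    subst h1
    have h2 := congrArg Complex.im h
    rw [slopePt_im, slopePt_im, div_left_inj' (by positivity)] at h2
    exact ⟨by exact_mod_cast h2.symm, hi'⟩
  · rintro ⟨rfl, hi⟩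
    exact ⟨i, hi, rfl⟩

theorem zero_notMem_slopeBlock (j N : ℕ) : (0 : ℂ) ∉ slopeBlock j N := by
  rintro ⟨i, -, h⟩
  exact slopePt_ne_zero j i h

theorem slopeBlock_subset {j N M : ℕ} (h : N ≤ M) : slopeBlock j N ⊆ slopeBlock j M :=
  Set.image_mono (Set.Iic_subset_Iic.mpr h)

theorem bvENorm_indicator_slopeBlock_le (k j N : ℕ) :
    bvENorm (fun z : slopeSet k => (slopeBlock j N).indicator (1 : ℂ → ℂ) z) ≤ 4 := by
  classical
  -- Two lines through the origin of slopes `j ± 1/2` cut off the other rays. The vertical line lies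
  -- between the abscissae `1 / (N + 1)` and `1 / (N + 2)` and cuts off the origin and the rest of
  -- the ray.
  let l : Fin 3 → PlaneLine := ![⟨-(j + 1 / 2), 1, 0, Or.inr one_ne_zero⟩,
    ⟨-(j - 1 / 2), 1, 0, Or.inr one_ne_zero⟩, ⟨1, 0, 1 / (N + 3 / 2), Or.inl one_ne_zero⟩]
  refine (bvENorm_le_of_separated l (fun z => ?_) fun z w hz hw => ?_).trans ?_
  · by_cases h : (z : ℂ) ∈ slopeBlock j N
    · exact Or.inr (Set.indicator_of_mem h _)
    · exact Or.inl (Set.indicator_of_notMem h _)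
  · have hz : (z : ℂ) ∉ slopeBlock j N := fun h => by
      rw [Set.indicator_of_mem h] at hz
      exact one_ne_zero hz
    have hw : (w : ℂ) ∈ slopeBlock j N := by
      by_contra h
      rw [Set.indicator_of_notMem h] at hw
      exact zero_ne_one hw
    obtain ⟨i, hi, hiw⟩ := hw
    have hi' : (i : ℝ) ≤ N := by exact_mod_cast hi
    have hx := slopePt_re_pos j i
    have w0 : (l 0).eval w < 0 := by
      have : (l 0).eval w = -(1 / 2) * (slopePt j i).re := by
        rw [← hiw]
        simp [l, PlaneLine.eval, slopePt_re, slopePt_im]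
        ring
      rw [this]; linarith
    have w1 : 0 < (l 1).eval w := by
      have : (l 1).eval w = (1 / 2) * (slopePt j i).re := by
        rw [← hiw]
        simp [l, PlaneLine.eval, slopePt_re, slopePt_im]
        ring
      rw [this]; linarith
    have w2 : 0 < (l 2).eval w := by
      have : (l 2).eval w = 1 / (i + 1) - 1 / (N + 3 / 2) := by
        rw [← hiw]
        simp [l, PlaneLine.eval, slopePt_re]
      rw [this, sub_pos]
      exact one_div_lt_one_div_of_lt (by positivity) (by linarith)
    have far : (l 2).eval z < 0 → ∃ s, (l s).Opposite z w := fun h =>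
      ⟨2, mul_neg_of_neg_of_pos h w2⟩
    obtain hz0 | ⟨j', hj', i', hz'⟩ := mem_slopeSet.mp z.2
    · refine far ?_
      have : (l 2).eval z = -(1 / (N + 3 / 2)) := by
        rw [hz0]
        simp [l, PlaneLine.eval]
      rw [this, neg_lt_zero]
      positivity
    · have hx' := slopePt_re_pos j' i'
      have e0 : (l 0).eval z = (j' - j - 1 / 2) * (slopePt j' i').re := by
        rw [hz']
        simp [l, PlaneLine.eval, slopePt_re, slopePt_im]
        ring
      have e1 : (l 1).eval z = (j' - j + 1 / 2) * (slopePt j' i').re := by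
        rw [hz']
        simp [l, PlaneLine.eval, slopePt_re, slopePt_im]
        ring
      rcases lt_trichotomy j' j with h | h | h
      · have : (j' : ℝ) + 1 ≤ j := by exact_mod_cast h
        refine ⟨1, mul_neg_of_neg_of_pos ?_ w1⟩
        rw [e1]
        exact mul_neg_of_neg_of_pos (by linarith) hx'
      · refine far ?_
        have hN : N < i' := by
          by_contra hN
          exact hz (hz' ▸ slopePt_mem_slopeBlock.mpr ⟨h, not_lt.mp hN⟩)
        have hN' : (N : ℝ) + 1 ≤ i' := by exact_mod_cast hN
        have : (l 2).eval z = 1 / (i' + 1) - 1 / (N + 3 / 2) := by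
          rw [hz']
          simp [l, PlaneLine.eval, slopePt_re]
        rw [this, sub_neg]
        exact one_div_lt_one_div_of_lt (by positivity) (by linarith)
      · have : (j : ℝ) + 1 ≤ j' := by exact_mod_cast h
        refine ⟨0, mul_neg_of_pos_of_neg ?_ w0⟩
        rw [e0]
        exact mul_pos (by linarith) hx'
  · rw [Fintype.card_fin]
    norm_num

theorem exists_AC_indicator_slopeBlock (k j N : ℕ) : ∃ f : AC (slopeSet k),
    ∀ z, BV.toFun (slopeSet k) f z = (slopeBlock j N).indicator (1 : ℂ → ℂ) z := by
  have hb : ∀ z ∈ slopeSet k, 0 ≤ z.re ∧ z.re ≤ 1 ∧ 0 ≤ z.im ∧ z.im ≤ k := by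
    intro z hz
    obtain rfl | ⟨j', hj', i, rfl⟩ := mem_slopeSet.mp hz
    · simp
    · have h : (j' : ℝ) ≤ k := by exact_mod_cast hj'
      have h1 : (1 : ℝ) ≤ i + 1 := by linarith [Nat.cast_nonneg (α := ℝ) i]
      refine ⟨(slopePt_re_pos _ _).le, ?_, ?_, ?_⟩
      · rw [slopePt_re]
        exact (div_le_one (by positivity)).mpr h1
      · rw [slopePt_im]
        positivity
      · rw [slopePt_im]
        exact (div_le_self (by positivity) h1).trans h
  -- The indicator is a product of two smooth cutoffs. This one, in `x`, is `1` at the abscissae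
  -- with `i ≤ N` and `0` at all smaller ones.
  obtain ⟨f, hf⟩ := exists_AC_toFun_comp (σ := slopeSet k) (a := 1) (b := 0) (p := 0) (q := 1)
    (g := fun t => Real.smoothTransition (((N + 2) * t - 1) * (N + 1)))
    (Or.inl one_ne_zero) one_pos
    (fun z hz => by
      obtain ⟨h1, h2, -, -⟩ := hb z hz
      exact ⟨by linarith, by linarith⟩)
    (Real.smoothTransition.contDiff.comp (by fun_prop))
  -- This cutoff, in `y - j x`, is `1` on ray `j`. On another ray `|y - j x| ≥ 1 / (i + 1)`, so it
  -- vanishes whenever `i ≤ N`; farther in, the first factor vanishes. The interval is enlarged by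
  -- one at each end to be nondegenerate even when `j = k = 0`.
  obtain ⟨g, hg⟩ := exists_AC_toFun_comp (σ := slopeSet k) (a := -j) (b := 1)
    (p := -(j + 1)) (q := k + 1)
    (g := fun t => 1 - Real.smoothTransition ((N + 1) ^ 2 * t ^ 2))
    (Or.inr one_ne_zero) (by linarith [Nat.cast_nonneg (α := ℝ) j, Nat.cast_nonneg (α := ℝ) k])
    (fun z hz => by
      obtain ⟨h1, h2, h3, h4⟩ := hb z hz
      have hj := Nat.cast_nonneg (α := ℝ) j
      have h5 := mul_nonneg hj h1
      have h6 := mul_le_mul_of_nonneg_left h2 hj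
      exact ⟨by linarith, by linarith⟩)
    (contDiff_const.sub (Real.smoothTransition.contDiff.comp (by fun_prop)))
  refine ⟨f * g, fun z => ?_⟩
  have e : BV.toFun (slopeSet k) ((f * g : AC (slopeSet k)) : BV (slopeSet k)) z =
      BV.toFun (slopeSet k) f z * BV.toFun (slopeSet k) g z := by
    rw [MulMemClass.coe_mul, map_mul, Pi.mul_apply]
  rw [e, hf, hg]
  obtain hz0 | ⟨j', hj', i, hz'⟩ := mem_slopeSet.mp z.2
  · have hN : -1 * ((N : ℝ) + 1) ≤ 0 := by
      linarith [Nat.cast_nonneg (α := ℝ) N]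
    rw [hz0, Set.indicator_of_notMem (zero_notMem_slopeBlock j N)]
    simp only [Complex.zero_re, Complex.zero_im, mul_zero, add_zero, zero_sub]
    rw [Real.smoothTransition.zero_of_nonpos hN]
    simp
  · have hi0 : (0 : ℝ) < i + 1 := by positivity
    rw [hz', slopePt_re, slopePt_im]
    by_cases hiN : i ≤ N
    · have hiN' : (i : ℝ) ≤ N := by exact_mod_cast hiN
      have h1 : (1 : ℝ) ≤ ((N + 2) * (1 * (1 / (i + 1)) + 0 * (j' / (i + 1))) - 1) * (N + 1) := by
        have e1 : ((N + 2) * (1 * (1 / ((i : ℝ) + 1)) + 0 * (j' / (i + 1))) - 1) * (N + 1) =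
            (N + 1 - i) * ((N + 1) / (i + 1)) := by
          field_simp
          ring
        rw [e1]
        refine one_le_mul_of_one_le_of_one_le (by linarith) ?_
        rw [one_le_div hi0]
        linarith
      rw [Real.smoothTransition.one_of_one_le h1]
      by_cases hj : j' = j
      · subst hj
        rw [Set.indicator_of_mem (slopePt_mem_slopeBlock.mpr ⟨rfl, hiN⟩)]
        have e2 : -(j' : ℝ) * (1 / (i + 1)) + 1 * (j' / (i + 1)) = 0 := by ring
        rw [e2]
        simp
      · rw [Set.indicator_of_notMem fun h => hj (slopePt_mem_slopeBlock.mp h).1]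
        have h2 : (1 : ℝ) ≤ (N + 1) ^ 2 * (-(j : ℝ) * (1 / (i + 1)) + 1 * (j' / (i + 1))) ^ 2 := by
          have e2 : (N + 1) ^ 2 * (-(j : ℝ) * (1 / (i + 1)) + 1 * (j' / (i + 1))) ^ 2 =
              ((N + 1) / (i + 1)) ^ 2 * ((j' : ℝ) - j) ^ 2 := by
            field_simp
            ring
          rw [e2]
          refine one_le_mul_of_one_le_of_one_le (one_le_pow₀ ?_) ?_
          · rw [one_le_div hi0]
            linarith
          · have h3 : (1 : ℤ) ≤ ((j' : ℤ) - j) ^ 2 := by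
              have : (j' : ℤ) - j ≠ 0 := by omega
              have := sq_pos_of_ne_zero this
              omega
            exact_mod_cast h3
        rw [Real.smoothTransition.one_of_one_le h2]
        simp
    · have hiN' : (N : ℝ) + 1 ≤ i := by exact_mod_cast not_le.mp hiN
      rw [Set.indicator_of_notMem fun h => hiN (slopePt_mem_slopeBlock.mp h).2]
      have h1 : ((N + 2) * (1 * (1 / ((i : ℝ) + 1)) + 0 * (j' / (i + 1))) - 1) * (N + 1) ≤ 0 := by
        refine mul_nonpos_of_nonpos_of_nonneg ?_ (by positivity)
        rw [one_mul, zero_mul, add_zero, mul_one_div, sub_nonpos, div_le_one hi0]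
        linarith
      rw [Real.smoothTransition.zero_of_nonpos h1]
      simp

/-! ### Variation along a single ray -/

/-- An affine function is strictly monotone or constant along the ray, so the points cross or enter
a line at most once; the clauses for the first and last segments add at most two. -/
theorem vf_slopePt_le (m n : ℕ) : vf n (slopePt m) ≤ 3 := by
  classical
  have : Nonempty PlaneLine := ⟨⟨1, 0, 0, Or.inl one_ne_zero⟩⟩
  refine ciSup_le fun l => ?_
  unfold vfLine
  split_ifs with hn h
  · norm_num
  · norm_num
  set α := l.a + l.b * m with hα
  have hv : ∀ i, l.eval (slopePt m i) = α * (1 / ((i : ℝ) + 1)) - l.c := fun i => by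
    rw [PlaneLine.eval, slopePt_re, slopePt_im, hα]
    ring
  let v : ℕ → ℝ := fun i => l.eval (slopePt m i)
  have hsmono : ∀ {i i' : ℕ}, i < i' → 1 / ((i' : ℝ) + 1) < 1 / ((i : ℝ) + 1) := fun h =>
    Nat.one_div_lt_one_div h
  let T : Finset ℕ := (Finset.range n).filter fun i => v i * v (i + 1) < 0 ∨
    (0 < i ∧ v i = 0 ∧ v (i - 1) ≠ 0)
  have hT : T.card ≤ 1 := by
    rw [Finset.card_le_one]
    suffices H : ∀ i ∈ T, ∀ i' ∈ T, ¬ i < i' from fun i hi i' hi' =>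
      le_antisymm (not_lt.mp (H i' hi' i hi)) (not_lt.mp (H i hi i' hi'))
    intro i hi i' hi' hlt
    have hi := (Finset.mem_filter.mp hi).2
    have hi' := (Finset.mem_filter.mp hi').2
    have e : ∀ i, v i = α * (1 / ((i : ℝ) + 1)) - l.c := hv
    have hα0 : α ≠ 0 := by
      intro h0
      have hc : ∀ i, v i = -l.c := fun i => by rw [e, h0]; ring
      simp only [hc] at hi
      rcases hi with h | ⟨-, h, h'⟩
      · nlinarith
      · exact h' h
    rcases lt_or_gt_of_ne hα0 with hneg | hpos
    · have hs : ∀ {i i' : ℕ}, i < i' → v i < v i' := fun h => by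
        have := mul_lt_mul_of_neg_left (hsmono h) hneg
        rw [e, e]; linarith
      have hw : ∀ {i i' : ℕ}, i ≤ i' → v i ≤ v i' := fun h => by
        rcases h.eq_or_lt with rfl | h
        · exact le_rfl
        · exact (hs h).le
      have h1 : 0 < v (i + 1) := by
        have := hs (Nat.lt_succ_self i)
        rcases hi with h | ⟨-, h, -⟩
        · by_contra hle
          nlinarith
        · exact h ▸ this
      have h2 : v i' ≤ 0 := by
        have := hs (Nat.lt_succ_self i')
        rcases hi' with h | ⟨-, h, -⟩
        · by_contra hle
          nlinarith
        · exact h.le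
      exact absurd (hw (Nat.succ_le_of_lt hlt)) (not_le.mpr (h2.trans_lt h1))
    · have hs : ∀ {i i' : ℕ}, i < i' → v i' < v i := fun h => by
        have := mul_lt_mul_of_pos_left (hsmono h) hpos
        rw [e, e]; linarith
      have hw : ∀ {i i' : ℕ}, i ≤ i' → v i' ≤ v i := fun h => by
        rcases h.eq_or_lt with rfl | h
        · exact le_rfl
        · exact (hs h).le
      have h1 : v (i + 1) < 0 := by
        have := hs (Nat.lt_succ_self i)
        rcases hi with h | ⟨-, h, -⟩
        · by_contra hle
          nlinarith
        · exact h ▸ this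
      have h2 : 0 ≤ v i' := by
        have := hs (Nat.lt_succ_self i')
        rcases hi' with h | ⟨-, h, -⟩
        · by_contra hle
          nlinarith
        · exact h.ge
      exact absurd (hw (Nat.succ_le_of_lt hlt)) (not_le.mpr (h1.trans_le h2))
  calc _ ≤ (T ∪ {0, n - 1}).card := Finset.card_le_card fun i hi => by
        rw [Finset.mem_filter] at hi
        obtain ⟨hin, h | h | h | h⟩ := hi
        · exact Finset.mem_union_left _ (Finset.mem_filter.mpr ⟨hin, Or.inl h⟩)
        · exact Finset.mem_union_right _ (by simp [h.1])
        · exact Finset.mem_union_left _ (Finset.mem_filter.mpr ⟨hin, Or.inr h⟩)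
        · refine Finset.mem_union_right _ ?_
          have : i = n - 1 := by omega
          simp [this]
    _ ≤ T.card + ({0, n - 1} : Finset ℕ).card := Finset.card_union_le _ _
    _ ≤ 1 + 2 := add_le_add hT Finset.card_le_two
    _ = 3 := rfl

theorem sum_norm_sub_slopePt_le {k m : ℕ} (hm : m ≤ k) (f : BV (slopeSet k)) (n : ℕ) :
    ∑ i ∈ Finset.range n, ‖BV.toFun _ f ⟨slopePt m (i + 1), slopePt_mem hm _⟩ -
      BV.toFun _ f ⟨slopePt m i, slopePt_mem hm _⟩‖ ≤ 3 * ‖f‖ := by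
  let x : ℕ → slopeSet k := fun i => ⟨slopePt m i, slopePt_mem hm _⟩
  have h1 : cvar (BV.toFun _ f) n x ≤ 3 * bvENorm (BV.toFun _ f) := by
    have h := (cvar_div_le_var (BV.toFun _ f) n x).trans (le_add_self (a := var _)
      (b := supENorm (BV.toFun _ f)))
    have hv0 : (vf n (fun i => (x i : ℂ)) : ℝ≥0∞) ≠ 0 := by
      exact_mod_cast Nat.one_le_iff_ne_zero.mp (one_le_vf n (fun i => (x i : ℂ)))
    rw [ENNReal.div_le_iff hv0 (ENNReal.natCast_ne_top _), mul_comm] at h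
    refine h.trans ?_
    have hv : (vf n (fun i => (x i : ℂ)) : ℝ≥0∞) ≤ (3 : ℕ) := Nat.cast_le.mpr (vf_slopePt_le m n)
    exact mul_le_mul_left hv _
  have h2 := ENNReal.toReal_mono
    (ENNReal.mul_ne_top (by norm_num) (BV.bvENorm_ne_top f)) h1
  rw [cvar, ENNReal.toReal_sum fun _ _ => enorm_ne_top, ENNReal.toReal_mul] at h2
  simpa [BV.norm_def, x] using h2

/-- Every jump of an indicator has size one, so bounded variation allows only finitely many; past
the last jump the indicator is constant, and infinitude of `S` makes the constant `1`. -/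
theorem eventually_mem_of_infinite_of_sum_le {S : Set ℕ} (hS : S.Infinite) {K : ℝ}
    (hK : ∀ n, ∑ i ∈ Finset.range n,
      ‖S.indicator (1 : ℕ → ℂ) (i + 1) - S.indicator (1 : ℕ → ℂ) i‖ ≤ K) :
    ∃ i₀, ∀ i ≥ i₀, i ∈ S := by
  have hsum := summable_of_sum_range_le (fun i => norm_nonneg _) hK
  obtain ⟨i₀, hi₀⟩ := Filter.eventually_atTop.mp
    (hsum.tendsto_atTop_zero.eventually_lt_const one_pos)
  obtain ⟨i₁, hi₁, hle⟩ := hS.exists_gt i₀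
  refine ⟨i₁, fun i hi => ?_⟩
  induction i, hi using Nat.le_induction with
  | base => exact hi₁
  | succ i hi ih =>
    by_contra h
    have := hi₀ i (hle.le.trans hi)
    rw [Set.indicator_of_mem ih, Set.indicator_of_notMem h] at this
    simp at this

/-! ### Increasing sequences of idempotents and tails of rays -/

theorem exists_infinite_slopePt {k : ℕ} {A : Set (slopeSet k)} (hA : A.Infinite) :
    ∃ m : Fin (k + 1),
      {i | (⟨slopePt m i, slopePt_mem (Nat.le_of_lt_succ m.2) i⟩ : slopeSet k) ∈ A}.Infinite := by
  by_contra! hfin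
  refine (hA.image Subtype.val_injective.injOn)
    (((Set.finite_singleton (0 : ℂ)).union
      (Set.finite_iUnion fun m => (hfin m).image (slopePt m))).subset ?_)
  rintro _ ⟨z, hz, rfl⟩
  obtain h0 | ⟨j, hj, i, hji⟩ := mem_slopeSet.mp z.2
  · exact Or.inl h0
  · refine Or.inr (Set.mem_iUnion.mpr ⟨⟨j, Nat.lt_succ_of_le hj⟩, i, ?_, hji.symm⟩)
    have e : (⟨slopePt j i, slopePt_mem hj i⟩ : slopeSet k) = z := Subtype.ext hji.symm
    change (⟨slopePt j i, slopePt_mem hj i⟩ : slopeSet k) ∈ A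
    rwa [e]

/-- A uniformly bounded, strictly increasing sequence of idempotents of `AC` of a slope set has
supports which absorb a tail of one of the rays. -/
theorem exists_tail_of_idempotents {k : ℕ} {e : ℕ → AC (slopeSet k)} {K : ℝ}
    (hK : ∀ N, ‖e N‖ ≤ K) (hmul : ∀ N M, N ≤ M → e N * e M = e N)
    (hne : ∀ N, e N ≠ e (N + 1)) :
    ∃ m : Fin (k + 1), ∃ i₀, ∀ i ≥ i₀, ∃ N₀, ∀ N ≥ N₀,
      BV.toFun _ (e N : BV (slopeSet k))
        ⟨slopePt m i, slopePt_mem (Nat.le_of_lt_succ m.2) i⟩ = 1 := by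
  classical
  let F : ℕ → slopeSet k → ℂ := fun N => BV.toFun _ (e N : BV (slopeSet k))
  have hF : ∀ {N M : ℕ}, N ≤ M → ∀ z, F N z * F M z = F N z := fun {N M} h z => by
    have := congrArg (fun f : AC (slopeSet k) => BV.toFun _ (f : BV (slopeSet k)) z) (hmul N M h)
    simpa only [MulMemClass.coe_mul, map_mul, Pi.mul_apply] using this
  have h01 : ∀ N z, F N z = 0 ∨ F N z = 1 := fun N z => by
    have := hF le_rfl z (N := N)
    rcases eq_or_ne (F N z) 0 with h | h
    · exact Or.inl h
    · exact Or.inr (mul_left_cancel₀ h (this.trans (mul_one _).symm))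
  have hmono : ∀ {N M : ℕ}, N ≤ M → ∀ {z}, F N z = 1 → F M z = 1 := fun h z hz => by
    have := hF h z
    rwa [hz, one_mul] at this
  let A : Set (slopeSet k) := {z | ∃ N, F N z = 1}
  -- Strict increase adds a new point to the support at each stage; these points are distinct, so
  -- the union `A` of the supports is infinite.
  have hstep : ∀ N, ∃ z, F N z = 0 ∧ F (N + 1) z = 1 := fun N => by
    by_contra! h
    refine hne N (Subtype.ext (BV.toFun_injective (funext fun z => ?_)))
    change F N z = F (N + 1) z
    rcases h01 N z with h0 | h1
    · rw [h0, (h01 (N + 1) z).resolve_right (h z h0)]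
    · rw [h1, hmono N.le_succ h1]
  choose z hz0 hz1 using hstep
  have hlt : ∀ {N M : ℕ}, N < M → z N ≠ z M := fun {N M} h heq => by
    have h1 := hmono (Nat.succ_le_of_lt h) (hz1 N)
    rw [heq, hz0] at h1
    exact zero_ne_one h1
  have hzinj : Function.Injective z := fun N M h => by
    by_contra hNM
    rcases lt_or_gt_of_ne hNM with h' | h'
    · exact hlt h' h
    · exact hlt h' h.symm
  have hA : A.Infinite := (Set.infinite_range_of_injective hzinj).mono (by
    rintro _ ⟨N, rfl⟩
    exact ⟨N + 1, hz1 N⟩)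
  obtain ⟨m, hm⟩ := exists_infinite_slopePt hA
  have hmk : (m : ℕ) ≤ k := Nat.le_of_lt_succ m.2
  let x : ℕ → slopeSet k := fun i => ⟨slopePt m i, slopePt_mem hmk i⟩
  let S : Set ℕ := {i | x i ∈ A}
  have hlim : ∀ i, ∃ N₀, ∀ N ≥ N₀, F N (x i) = S.indicator (1 : ℕ → ℂ) i := fun i => by
    by_cases hi : i ∈ S
    · obtain ⟨N₀, hN₀⟩ := id hi
      refine ⟨N₀, fun N hN => ?_⟩
      rw [Set.indicator_of_mem hi]
      exact hmono hN hN₀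
    · refine ⟨0, fun N _ => ?_⟩
      rw [Set.indicator_of_notMem hi]
      exact (h01 N _).resolve_right fun h => hi ⟨N, h⟩
  choose N₀ hN₀ using hlim
  have hsum : ∀ n, ∑ i ∈ Finset.range n,
      ‖S.indicator (1 : ℕ → ℂ) (i + 1) - S.indicator (1 : ℕ → ℂ) i‖ ≤ 3 * K := fun n => by
    -- One idempotent already agrees with the limit indicator at the first `n + 1` points of the
    -- ray, so its norm bound carries over to the limit.
    let N := (Finset.range (n + 1)).sup N₀
    have hN : ∀ i ≤ n, F N (x i) = S.indicator (1 : ℕ → ℂ) i := fun i hi =>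
      hN₀ i N (Finset.le_sup (Finset.mem_range.mpr (Nat.lt_succ_of_le hi)))
    calc _ = ∑ i ∈ Finset.range n, ‖F N (x (i + 1)) - F N (x i)‖ := by
          refine Finset.sum_congr rfl fun i hi => ?_
          have := Finset.mem_range.mp hi
          rw [hN i this.le, hN (i + 1) this]
      _ ≤ 3 * ‖e N‖ := sum_norm_sub_slopePt_le hmk (e N : BV (slopeSet k)) n
      _ ≤ 3 * K := by linarith [hK N]
  obtain ⟨i₀, hi₀⟩ := eventually_mem_of_infinite_of_sum_le hm hsum
  refine ⟨m, i₀, fun i hi => ⟨N₀ i, fun N hN => ?_⟩⟩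
  have := hN₀ i N hN
  rwa [Set.indicator_of_mem (show i ∈ S from hi₀ i hi)] at this

/-! ### Counting rays -/

theorem le_of_AC_slopeSet_hom {k l : ℕ} (Φ : AC (slopeSet l) →A[ℂ] AC (slopeSet k))
    (hΦ : Function.Injective Φ) : l ≤ k := by
  choose E hE using fun (j : Fin (l + 1)) N => exists_AC_indicator_slopeBlock l j N
  have hext : ∀ {f g : AC (slopeSet l)},
      (∀ z, BV.toFun _ (f : BV (slopeSet l)) z = BV.toFun _ (g : BV (slopeSet l)) z) → f = g :=
    fun h => Subtype.ext (BV.toFun_injective (funext h))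
  have hmul : ∀ (f g : AC (slopeSet l)) z, BV.toFun _ ((f * g : AC _) : BV (slopeSet l)) z =
      BV.toFun _ (f : BV (slopeSet l)) z * BV.toFun _ (g : BV (slopeSet l)) z := fun f g z => by
    rw [MulMemClass.coe_mul, map_mul, Pi.mul_apply]
  have hEmul : ∀ j N M, N ≤ M → E j N * E j M = E j N := fun j N M h => hext fun z => by
    rw [hmul, hE, hE]
    by_cases hz : (z : ℂ) ∈ slopeBlock j N
    · rw [Set.indicator_of_mem hz, Set.indicator_of_mem (slopeBlock_subset h hz), Pi.one_apply,
        one_mul]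
    · rw [Set.indicator_of_notMem hz, zero_mul]
  have hEne : ∀ j N, E j N ≠ E j (N + 1) := fun j N h => by
    have hj : (j : ℕ) ≤ l := Nat.le_of_lt_succ j.2
    have h1 := hE j N ⟨slopePt j (N + 1), slopePt_mem hj _⟩
    rw [h, hE, Set.indicator_of_mem (slopePt_mem_slopeBlock.mpr ⟨rfl, le_rfl⟩),
      Set.indicator_of_notMem fun h' => absurd (slopePt_mem_slopeBlock.mp h').2 (by omega)] at h1
    exact one_ne_zero h1
  have hEdisj : ∀ {j j'}, j ≠ j' → ∀ N M, E j N * E j' M = 0 := fun {j j'} hjj N M =>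
    hext fun z => by
      rw [hmul, hE, hE]
      by_cases hz : (z : ℂ) ∈ slopeBlock j N
      · obtain ⟨i, -, hi⟩ := hz
        rw [← hi, Set.indicator_of_notMem (s := slopeBlock j' M) fun h' =>
          hjj (Fin.ext (slopePt_mem_slopeBlock.mp h').1), mul_zero]
        simp
      · rw [Set.indicator_of_notMem hz, zero_mul]
        simp
  have hEnorm : ∀ j N, ‖E j N‖ ≤ 4 := fun j N => by
    have h : BV.toFun _ (E j N : BV (slopeSet l)) =
        fun z : slopeSet l => (slopeBlock j N).indicator (1 : ℂ → ℂ) z := funext (hE j N)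
    change ‖(E j N : BV (slopeSet l))‖ ≤ 4
    rw [BV.norm_def, h]
    exact ENNReal.toReal_mono (by norm_num) (bvENorm_indicator_slopeBlock_le l j N)
  -- The operator norm keeps the images of the idempotents bounded uniformly in `N`; this is where
  -- continuity enters.
  let T : AC (slopeSet l) →L[ℂ] AC (slopeSet k) := ⟨Φ.toAlgHom.toLinearMap, Φ.cont⟩
  have hnorm : ∀ j N, ‖Φ (E j N)‖ ≤ ‖T‖ * 4 := fun j N =>
    (T.le_opNorm (E j N)).trans (mul_le_mul_of_nonneg_left (hEnorm j N) (norm_nonneg _))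
  choose m i₀ hm using fun j => exists_tail_of_idempotents (e := fun N => Φ (E j N)) (hnorm j)
    (fun N M h => by rw [← map_mul, hEmul j N M h]) (fun N h => hEne j N (hΦ h))
  have hinj : Function.Injective m := fun j j' hjj => by
    by_contra hne
    -- If two sequences absorbed tails of one ray, then at a point common to both tails late members
    -- of each would equal `1`, although their product is `0`.
    obtain ⟨N, hN⟩ := hm j (max (i₀ j) (i₀ j')) (le_max_left _ _)
    obtain ⟨M, hM⟩ := hm j' (max (i₀ j) (i₀ j')) (le_max_right _ _)
    have h1 := hN N le_rfl
    have h2 := hM M le_rfl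
    have h0 : Φ (E j N) * Φ (E j' M) = 0 := by rw [← map_mul, hEdisj hne, map_zero]
    have h3 := congrArg (fun f : AC (slopeSet k) => BV.toFun _ (f : BV (slopeSet k))
      ⟨slopePt (m j) (max (i₀ j) (i₀ j')), slopePt_mem (Nat.le_of_lt_succ (m j).2) _⟩) h0
    simp only [MulMemClass.coe_mul, map_mul, Pi.mul_apply] at h3
    rw [h1] at h3
    simp only [hjj] at h3
    rw [h2] at h3
    simp at h3
  have := Fintype.card_le_of_injective m hinj
  simpa using this

theorem mainTheorem2 :
    (∀ σ τ : Set ℂ, IsCSet σ → IsCSet τ → Nonempty (σ ≃ₜ τ)) ∧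
    ∃ σ : ℕ → Set ℂ,
      (∀ k : ℕ, IsRaySet (k + 1) (σ k)) ∧
      ∀ k l : ℕ, k ≠ l → IsEmpty (AC (σ k) ≃A[ℂ] AC (σ l)) := by
  refine ⟨fun σ τ hσ hτ => ?_, slopeSet, isRaySet_slopeSet, fun k l hkl => ⟨fun e => hkl ?_⟩⟩
  · obtain ⟨f⟩ := hσ.nonempty_homeomorph
    obtain ⟨g⟩ := hτ.nonempty_homeomorph
    exact ⟨f.symm.trans g⟩
  · exact le_antisymm (le_of_AC_slopeSet_hom (e : AC (slopeSet k) →A[ℂ] AC (slopeSet l)) e.injective)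
      (le_of_AC_slopeSet_hom (e.symm : AC (slopeSet l) →A[ℂ] AC (slopeSet k)) e.symm.injective)
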